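/- Let $n\ge 0$, $V=\{1,\dots,n\}$, and let $\tau$ be an arbitrary permutation of $V$ with disjoint cycles $\tau_1,\dots,\tau_k$ (fixed points count as cycles of length $1$, so the cycles partition $V$); write $|\tau_i|$ for the length of $\tau_i$. Equip the set $\mathbb{Z}^n$ of maps $\phi:V\to\mathbb{Z}$ with the associative multiplication $$(\phi*\psi)(v)=\phi(v)+\psi\bigl(\tau^{\phi(v)}(v)\bigr),$$ whose identity is $0$, and let $\mathfrak{T}_n^\tau\subset\mathbb{Z}^n$ be the group of its invertible elements. For $m\ge 1$ let $\Pi_{m-1}\subset\mathbb{R}^m$ be the $(m-1)$-dimensional permutohedron, i.e. the convex hull of the $m!$ points obtained from $(1,2,\dots,m)$ by permuting the coordinates, and let $I=[0,1]$. Then: (1) There is a tessellation of $\mathbb{R}^n$ (a locally finite covering by full-dimensional convex polytopes with pairwise disjoint interiors, any two different ones being disjoint or meeting in a common face) by polytopes of the form $$\Pi_{|\tau_1|-1}\times\dots\times\Pi_{|\tau_k|-1}\times I^k$$ such that the set of all vertices of all these polytopes is exactly $\mathfrak{T}_n^\tau$. More precisely, every polytope of the tessellation is, under $\mathbb{R}^n=\mathbb{R}^{|\tau_1|}\times\dots\times\mathbb{R}^{|\tau_k|}$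 (the coordinates being grouped by cycles), the image of this product under an affine map that is injective on it and has the form $(x_1,\dots,x_k,t_1,\dots,t_k)\mapsto \bigl(x_i+t_i(1,\dots,1)\bigr)_{i=1}^{k}+w$ with $w\in\mathbb{R}^n$. In particular, all the polytopes are translates of one another. (2) $\mathfrak{T}_n^\tau\cong\prod_{i=1}^k\bigl(\mathbb{Z}^{|\tau_i|}\rtimes S_{|\tau_i|}\bigr)$, where $S_m$ acts on $\mathbb{Z}^m$ by permuting the coordinates. -/

import Mathlib

/-- The set `ℤ^V` of maps `V → ℤ`, attached to a permutation `τ` of `V`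
(the integer `a` acts on `V` by `v ↦ τ ^ a v`). It carries the deformed multiplication below. -/
@[ext]
structure TwistedMap {V : Type*} (τ : Equiv.Perm V) where
  /-- The underlying map `V → ℤ`. -/
  toFun : V → ℤ

namespace TwistedMap

/-- The deformed multiplication `(φ * ψ)(v) = φ(v) + ψ(v · φ(v))`, where `v · a = τ ^ a v`,
with the zero map as identity. -/
instance instMonoid {V : Type*} (τ : Equiv.Perm V) : Monoid (TwistedMap τ) where
  mul φ ψ := ⟨fun v => φ.toFun v + ψ.toFun ((τ ^ φ.toFun v) v)⟩
  one := ⟨fun _ => 0⟩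
  mul_assoc φ ψ χ := by
    apply TwistedMap.ext
    funext v
    change φ.toFun v + ψ.toFun ((τ ^ φ.toFun v) v)
        + χ.toFun ((τ ^ (φ.toFun v + ψ.toFun ((τ ^ φ.toFun v) v))) v)
      = φ.toFun v + (ψ.toFun ((τ ^ φ.toFun v) v)
        + χ.toFun ((τ ^ ψ.toFun ((τ ^ φ.toFun v) v)) ((τ ^ φ.toFun v) v)))
    rw [add_comm (φ.toFun v) (ψ.toFun ((τ ^ φ.toFun v) v)), zpow_add, Equiv.Perm.mul_apply]
    ring
  one_mul φ := by
    apply TwistedMap.ext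
    funext v
    change 0 + φ.toFun ((τ ^ (0 : ℤ)) v) = φ.toFun v
    simp
  mul_one φ := by
    apply TwistedMap.ext
    funext v
    change φ.toFun v + 0 = φ.toFun v
    simp

end TwistedMap

/-- The group of invertible elements of `ℤ^V` with the multiplication deformed by `τ`. -/
abbrev InvertibleGroup {V : Type*} (τ : Equiv.Perm V) : Type _ := (TwistedMap τ)ˣ

/-- The invertible elements as points of the real space `ℝ^V`. -/
def invertiblePoints {V : Type*} (τ : Equiv.Perm V) : Set (V → ℝ) :=
  Set.range fun (φ : InvertibleGroup τ) (v : V) => ((φ : TwistedMap τ).toFun v : ℝ)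

/-- The disjoint cycles of `τ`, fixed points being cycles of length one. -/
abbrev Cycles {V : Type*} (τ : Equiv.Perm V) : Type _ := Quotient (Equiv.Perm.SameCycle.setoid τ)

/-- The cycle of `τ` through `v`. -/
def cycleThrough {V : Type*} (τ : Equiv.Perm V) (v : V) : Cycles τ :=
  Quotient.mk (Equiv.Perm.SameCycle.setoid τ) v

/-- The elements that the cycle `c` moves around. -/
abbrev CycleElems {V : Type*} (τ : Equiv.Perm V) (c : Cycles τ) : Type _ :=
  {v : V // cycleThrough τ v = c}

/-- The length `|c|` of the cycle `c`. -/
noncomputable def cycleLength {V : Type*} (τ : Equiv.Perm V) (c : Cycles τ) : ℕ :=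
  Nat.card (CycleElems τ c)

/-- A numbering of the elements of the cycle `c` by `0, …, |c| - 1`. Which one is irrelevant
below, because permutohedra are invariant under permutations of the coordinates. -/
noncomputable def cycleNumbering {V : Type*} [Finite V] (τ : Equiv.Perm V) (c : Cycles τ) :
    CycleElems τ c ≃ Fin (cycleLength τ c) :=
  Finite.equivFin (CycleElems τ c)

/-- The `(m - 1)`-dimensional permutohedron: the convex hull in `ℝ^m` of the `m!` points obtained
from `(1, 2, …, m)` by permuting the coordinates. -/
def permutohedron (m : ℕ) : Set (Fin m → ℝ) :=
  convexHull ℝ (Set.range fun (s : Equiv.Perm (Fin m)) (i : Fin m) => ((s i : ℕ) : ℝ) + 1)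

/-- The product of the permutohedra of dimensions `|c| - 1`, over all `k` cycles `c` of `τ`, and
of the cube `[0, 1]^k`. -/
def permutohedraProd {V : Type*} (τ : Equiv.Perm V) :
    Set (((c : Cycles τ) → Fin (cycleLength τ c) → ℝ) × (Cycles τ → ℝ)) :=
  (Set.univ.pi fun c => permutohedron (cycleLength τ c)) ×ˢ
    (Set.univ.pi fun _ => Set.Icc (0 : ℝ) 1)

/-- The affine map that places the product in `ℝ^V = ∏ ℝ^|c|`, with translation vector `w`. In the
factor of the cycle `c` it is `(x, t) ↦ x + t (1, …, 1) + w`: the permutohedron is translated, and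
the segment is put in the direction orthogonal to it. -/
noncomputable def placeProd {V : Type*} [Finite V] (τ : Equiv.Perm V) (w : V → ℝ)
    (p : ((c : Cycles τ) → Fin (cycleLength τ c) → ℝ) × (Cycles τ → ℝ)) : V → ℝ :=
  fun v => p.1 (cycleThrough τ v) (cycleNumbering τ (cycleThrough τ v) ⟨v, rfl⟩)
    + p.2 (cycleThrough τ v) + w v

/-- A (face-to-face) tessellation of a real space by convex polytopes. -/
structure IsTessellation {E : Type*} [AddCommGroup E] [Module ℝ E] [TopologicalSpace E]
    (T : Set (Set E)) : Prop where
  /-- Every tile is a polytope, the convex hull of finitely many points. -/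
  polytope : ∀ P ∈ T, ∃ s : Set E, s.Finite ∧ P = convexHull ℝ s
  /-- Every tile is full-dimensional. -/
  fullDim : ∀ P ∈ T, (interior P).Nonempty
  /-- The tiles cover the space. -/
  cover : ⋃₀ T = Set.univ
  /-- Different tiles do not overlap. -/
  noOverlap : ∀ P ∈ T, ∀ Q ∈ T, P ≠ Q → Disjoint (interior P) (interior Q)
  /-- Different tiles are disjoint or meet in a common face (`IsExposed` holds for `∅`). -/
  faceToFace : ∀ P ∈ T, ∀ Q ∈ T, P ≠ Q → IsExposed ℝ P (P ∩ Q) ∧ IsExposed ℝ Q (P ∩ Q)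
  /-- The family of tiles is locally finite. -/
  locallyFinite : LocallyFinite fun P : T => (P : Set E)

/-- The semidirect product `ℤ^m ⋊ S_m`, where `S_m` permutes the coordinates. -/
abbrev LatticeSemidirect (m : ℕ) : Type :=
  (Fin m → Multiplicative ℤ) ⋊[mulAutArrow (G := Equiv.Perm (Fin m)) (A := Fin m)
    (M := Multiplicative ℤ)] Equiv.Perm (Fin m)

/-! A map `φ` is invertible iff `v ↦ τ ^ φ(v) v` permutes `V`. On a cycle of length `m` whose
elements have positions `pos`, this says that `φ + pos` hits every residue mod `m` once, i.e. that
it is a permutation of `(1, …, m)` plus a vector of `m ℤ^m`; adding an integer multiple of `(1, …,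
1)` changes nothing. So the invertible points are the vertices of translates of the prism over the
permutohedron by the lattice `m ℤ^m + ℤ (1, …, 1)`.

The centred prism is the Voronoi cell of `0` in this lattice (`forall_two_mul_sum_mul_le_iff`).
Diagonal lattice vectors bound the segment coordinate, and the vectors `m 1_S - |S| (1, …, 1)` give
Rado's inequalities for the permutohedron. That no other lattice vector cuts deeper follows from
`|j| ≤ j ^ 2` for integers (`two_mul_sum_mul_le`). Cells of product lattices are products, so the
tiles are Voronoi cells, and these always tessellate face to face (`isTessellation_voronoi`).

For the group, `φ` is recorded by the permutation it induces on each cycle and by its winding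
numbers, which obey the multiplication law of the semidirect product. -/

theorem Int.abs_le_sq (j : ℤ) : |j| ≤ j ^ 2 := by
  rw [← sq_abs]
  rcases (abs_nonneg j).eq_or_lt with h | h
  · simp [← h]
  · nlinarith

/-- The Voronoi cell, among the sites `A`, of the point `a` of the Euclidean space `ℝ^V`. -/
def voronoiCell {V : Type*} [Fintype V] (A : Set (V → ℝ)) (a : V → ℝ) : Set (V → ℝ) :=
  {x | ∀ b ∈ A, ∑ v, (x v - a v) ^ 2 ≤ ∑ v, (x v - b v) ^ 2}

/-! ### Voronoi tessellations -/

section Voronoi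

variable {V : Type*} [Fintype V] {A : Set (V → ℝ)} {a b x : V → ℝ}

theorem sum_sq_sub_sub_sum_sq_sub (x a b : V → ℝ) :
    ∑ v, (x v - b v) ^ 2 - ∑ v, (x v - a v) ^ 2
      = ∑ v, (b v - a v) ^ 2 - 2 * ∑ v, (x v - a v) * (b v - a v) := by
  rw [Finset.mul_sum, ← Finset.sum_sub_distrib, ← Finset.sum_sub_distrib]
  exact Finset.sum_congr rfl fun v _ => by ring

theorem mem_voronoiCell_iff : x ∈ voronoiCell A a ↔
    ∀ b ∈ A, 2 * ∑ v, (x v - a v) * (b v - a v) ≤ ∑ v, (b v - a v) ^ 2 := by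
  refine forall₂_congr fun b _ => ?_
  have := sum_sq_sub_sub_sum_sq_sub x a b
  constructor <;> intro h <;> linarith

theorem mem_voronoiCell_inter_iff (ha : a ∈ A) (hb : b ∈ A) (hx : x ∈ voronoiCell A a) :
    x ∈ voronoiCell A b ↔ ∑ v, (x v - b v) ^ 2 = ∑ v, (x v - a v) ^ 2 :=
  ⟨fun h => le_antisymm (h a ha) (hx b hb), fun h c hc => h ▸ hx c hc⟩

/-- Common points of two cells lie on the bisecting hyperplane, and a small move along `b - a`
leaves it. -/
theorem disjoint_interior_voronoiCell (ha : a ∈ A) (hb : b ∈ A) (hab : a ≠ b) :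
    Disjoint (interior (voronoiCell A a)) (interior (voronoiCell A b)) := by
  rw [Set.disjoint_left]
  intro x hxa hxb
  have hlim : Filter.Tendsto (fun t : ℝ => fun v => x v + t * (b v - a v)) (nhds 0) (nhds x) := by
    have : Continuous (fun t : ℝ => fun v => x v + t * (b v - a v)) := by fun_prop
    simpa using this.tendsto 0
  have hev := hlim.eventually
    (((isOpen_interior.inter isOpen_interior).mem_nhds ⟨hxa, hxb⟩ : _ ∈ nhds x))
  obtain ⟨t, ht, ht0⟩ := ((hev.filter_mono nhdsWithin_le_nhds).and
    (self_mem_nhdsWithin : {(0 : ℝ)}ᶜ ∈ nhdsWithin 0 {0}ᶜ)).exists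
  have h1 := (mem_voronoiCell_inter_iff ha hb (interior_subset hxa)).1 (interior_subset hxb)
  have h2 := (mem_voronoiCell_inter_iff ha hb (interior_subset ht.1)).1 (interior_subset ht.2)
  have e1 := sum_sq_sub_sub_sum_sq_sub x a b
  have e2 := sum_sq_sub_sub_sum_sq_sub (fun v => x v + t * (b v - a v)) a b
  have e3 : ∑ v, (x v + t * (b v - a v) - a v) * (b v - a v)
      = ∑ v, (x v - a v) * (b v - a v) + t * ∑ v, (b v - a v) ^ 2 := by
    rw [Finset.mul_sum, ← Finset.sum_add_distrib]
    exact Finset.sum_congr rfl fun v _ => by ring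
  rw [e3] at e2
  have h0 : t * ∑ v, (b v - a v) ^ 2 = 0 := by linarith
  have hz := (mul_eq_zero.1 h0).resolve_left ht0
  rw [Finset.sum_eq_zero_iff_of_nonneg fun v _ => sq_nonneg _] at hz
  exact hab (funext fun v => by
    have := pow_eq_zero_iff (two_ne_zero) |>.1 (hz v (Finset.mem_univ v)); linarith)

/-- The functional `⟨·, b - a⟩` is bounded on the cell of `a` by its value on the bisector, so it is
maximal exactly on the common part. -/
theorem isExposed_voronoiCell_inter (ha : a ∈ A) (hb : b ∈ A) :
    IsExposed ℝ (voronoiCell A a) (voronoiCell A a ∩ voronoiCell A b) := by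
  rintro ⟨z, hza, hzb⟩
  refine ⟨∑ v, (b v - a v) • ContinuousLinearMap.proj (R := ℝ) (φ := fun _ : V => ℝ) v, ?_⟩
  have key : ∀ y : V → ℝ, (∑ v, (b v - a v) •
      ContinuousLinearMap.proj (R := ℝ) (φ := fun _ : V => ℝ) v) y
      = ∑ v, (y v - a v) * (b v - a v) + ∑ v, a v * (b v - a v) := by
    intro y
    rw [← Finset.sum_add_distrib]
    simp only [sum_apply, smul_apply,
      ContinuousLinearMap.proj_apply, smul_eq_mul]
    exact Finset.sum_congr rfl fun v _ => by ring
  have hz := (mem_voronoiCell_inter_iff ha hb hza).1 hzb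
  have ez := sum_sq_sub_sub_sum_sq_sub z a b
  ext x
  simp only [Set.mem_inter_iff, Set.mem_ofPred_eq, key]
  refine and_congr_right fun hx => ?_
  have ex := sum_sq_sub_sub_sum_sq_sub x a b
  rw [mem_voronoiCell_inter_iff ha hb hx]
  constructor
  · intro h y hy
    have ey := mem_voronoiCell_iff.1 hy b hb
    linarith
  · intro h
    have := h z hza
    have := mem_voronoiCell_iff.1 hx b hb
    linarith

/-- If `|x v - a v| < 1/2` for all `v`, then `2 (x v - a v) j ≤ |j| ≤ j ^ 2` in each coordinate, so
a sup-norm ball lies in the cell. -/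
theorem mem_interior_voronoiCell (hA : ∀ b ∈ A, ∀ v, ∃ j : ℤ, b v - a v = j) :
    a ∈ interior (voronoiCell A a) := by
  rw [mem_interior_iff_mem_nhds]
  filter_upwards [Metric.ball_mem_nhds a (by norm_num : (0 : ℝ) < 1 / 2)] with x hx
  rw [mem_voronoiCell_iff]
  intro b hb
  rw [Finset.mul_sum]
  refine Finset.sum_le_sum fun v _ => ?_
  obtain ⟨j, hj⟩ := hA b hb v
  have hv : |x v - a v| < 1 / 2 := by
    simpa [Real.dist_eq] using (dist_le_pi_dist x a v).trans_lt hx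
  have hj2 : |(j : ℝ)| ≤ (j : ℝ) ^ 2 := by exact_mod_cast Int.abs_le_sq j
  rw [hj]
  calc 2 * ((x v - a v) * j) ≤ 2 * (|x v - a v| * |(j : ℝ)|) := by
        rw [← abs_mul]; exact mul_le_mul_of_nonneg_left (le_abs_self _) zero_le_two
    _ ≤ |(j : ℝ)| := by nlinarith [abs_nonneg (j : ℝ)]
    _ ≤ _ := hj2

theorem finite_sites_near (hA : ∀ a ∈ A, ∀ b ∈ A, ∀ v, ∃ j : ℤ, b v - a v = j)
    (x : V → ℝ) (r : ℝ) : {a ∈ A | ∀ v, |x v - a v| ≤ r}.Finite := by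
  rcases A.eq_empty_or_nonempty with rfl | ⟨a₀, ha₀⟩
  · simp
  refine (Set.Finite.pi' (t := fun v => (fun j : ℤ => a₀ v + j) ''
    Set.Icc ⌊x v - r - a₀ v⌋ ⌈x v + r - a₀ v⌉) fun v => (Set.finite_Icc _ _).image _).subset ?_
  rintro b ⟨hb, hbr⟩ v
  obtain ⟨j, hj⟩ := hA a₀ ha₀ b hb v
  have := abs_le.1 (hbr v)
  refine ⟨j, ⟨?_, ?_⟩, by simp [← hj]⟩
  · exact Int.cast_le.1 ((Int.floor_le _).trans (by linarith : x v - r - a₀ v ≤ (j : ℝ)))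
  · exact Int.cast_le.1 ((by linarith : (j : ℝ) ≤ x v + r - a₀ v).trans (Int.le_ceil _))

theorem exists_mem_voronoiCell (hne : A.Nonempty)
    (hA : ∀ a ∈ A, ∀ b ∈ A, ∀ v, ∃ j : ℤ, b v - a v = j) (x : V → ℝ) :
    ∃ a ∈ A, x ∈ voronoiCell A a := by
  obtain ⟨a₀, ha₀⟩ := hne
  set d : (V → ℝ) → ℝ := fun a => ∑ v, (x v - a v) ^ 2 with hd
  have hfin : {a ∈ A | d a ≤ d a₀}.Finite := by
    -- A real whose square is at most `d` has absolute value at most `d + 1`.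
    refine (finite_sites_near hA x (d a₀ + 1)).subset fun a ha => ⟨ha.1, fun v => ?_⟩
    have h1 : (x v - a v) ^ 2 ≤ d a :=
      Finset.single_le_sum (f := fun v => (x v - a v) ^ 2) (fun v _ => sq_nonneg _)
        (Finset.mem_univ v)
    have h2 := ha.2
    rw [abs_le]
    constructor <;> nlinarith
  obtain ⟨a, ha, hmin⟩ := Set.exists_min_image _ d hfin ⟨a₀, ha₀, le_rfl⟩
  refine ⟨a, ha.1, fun b hb => ?_⟩
  by_cases h : d b ≤ d a₀
  · exact hmin b ⟨hb, h⟩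
  · exact ha.2.trans (not_le.1 h).le

/-- The Voronoi cells of a set of sites that differ by integer vectors form a tessellation, as soon
as they are polytopes of bounded size. -/
theorem isTessellation_voronoi (hne : A.Nonempty)
    (hA : ∀ a ∈ A, ∀ b ∈ A, ∀ v, ∃ j : ℤ, b v - a v = j)
    (hpoly : ∀ a ∈ A, ∃ s : Set (V → ℝ), s.Finite ∧ voronoiCell A a = convexHull ℝ s)
    {R : ℝ} (hR : ∀ a ∈ A, ∀ x ∈ voronoiCell A a, ∀ v, |x v - a v| ≤ R) :
    IsTessellation (voronoiCell A '' A) where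
  polytope := by rintro _ ⟨a, ha, rfl⟩; exact hpoly a ha
  fullDim := by
    rintro _ ⟨a, ha, rfl⟩
    exact ⟨a, mem_interior_voronoiCell (hA a ha)⟩
  cover := by
    refine Set.eq_univ_of_forall fun x => ?_
    obtain ⟨a, ha, hx⟩ := exists_mem_voronoiCell hne hA x
    exact ⟨_, ⟨a, ha, rfl⟩, hx⟩
  noOverlap := by
    rintro _ ⟨a, ha, rfl⟩ _ ⟨b, hb, rfl⟩ hne
    exact disjoint_interior_voronoiCell ha hb fun h => hne (by rw [h])
  faceToFace := by
    rintro _ ⟨a, ha, rfl⟩ _ ⟨b, hb, rfl⟩ -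
    exact ⟨isExposed_voronoiCell_inter ha hb,
      Set.inter_comm (voronoiCell A a) _ ▸ isExposed_voronoiCell_inter hb ha⟩
  locallyFinite := by
    intro x
    refine ⟨Metric.ball x 1, Metric.ball_mem_nhds x one_pos, ?_⟩
    refine Set.Finite.of_finite_image (f := Subtype.val) ?_ Subtype.val_injective.injOn
    -- A cell that meets the unit ball around `x` has its site within `R + 1` of `x`.
    refine ((finite_sites_near hA x (R + 1)).image (voronoiCell A)).subset ?_
    rintro _ ⟨⟨_, a, ha, rfl⟩, ⟨y, hy, hyx⟩, rfl⟩
    refine ⟨a, ⟨ha, fun v => ?_⟩, rfl⟩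
    have h1 := hR a ha y hy v
    have h2 : |y v - x v| < 1 := by
      simpa [Real.dist_eq] using (dist_le_pi_dist y x v).trans_lt hyx
    rw [abs_le] at *
    rw [abs_lt] at h2
    constructor <;> linarith

end Voronoi

/-! ### The permutohedron and the Voronoi cell of its lattice -/

section Permutohedron

open Finset in
theorem sum_sign_sub (m : ℕ) (i : Fin m) :
    ∑ j : Fin m, (SignType.sign ((i : ℤ) - (j : ℤ)) : ℤ) = 2 * (i : ℤ) + 1 - m := by
  have h : ∀ j : Fin m, (SignType.sign ((i : ℤ) - (j : ℤ)) : ℤ)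
      = (if j < i then 1 else 0) - (if i < j then 1 else 0) := by
    intro j
    rcases lt_trichotomy i j with h | h | h
    · have : (i : ℤ) - j < 0 := by have : (i : ℕ) < j := h; omega
      simp [sign_neg this, h, h.not_gt]
    · simp [h]
    · have : 0 < (i : ℤ) - j := by have : (j : ℕ) < i := h; omega
      simp [sign_pos this, h, h.not_gt]
  simp only [h, Finset.sum_sub_distrib, Finset.sum_boole]
  have h1 : #{j : Fin m | j < i} = i := by
    rw [Finset.filter_gt_eq_Iio]; simp
  have h2 : #{j : Fin m | i < j} = m - 1 - i := by
    rw [Finset.filter_lt_eq_Ioi]; simp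
  rw [h1, h2]
  have := i.2
  omega

/-- A discrete inequality saying that `0` is one of the points nearest to `(1, …, m)`, up to
centring, in the projection of `m ℤ^m` along the diagonal. -/
theorem two_mul_sum_mul_le {m : ℕ} (z : Fin m → ℤ) :
    2 * ∑ i : Fin m, ((i : ℤ) + 1) * z i - (m + 1) * ∑ i, z i
      ≤ m * ∑ i, z i ^ 2 - (∑ i, z i) ^ 2 := by
  -- Twice each side is a double sum over pairs: of `(z i - z j) ^ 2` on the right, of `sign (i - j)
  -- (z i - z j)` on the left. These compare term by term since `|j| ≤ j ^ 2` for integers.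
  have hsq : ∑ i, ∑ j, (z i - z j) ^ 2 = 2 * (m * ∑ i, z i ^ 2 - (∑ i, z i) ^ 2) := by
    have : ∀ i j, (z i - z j) ^ 2 = z i ^ 2 + z j ^ 2 - 2 * (z i * z j) := fun i j => by ring
    simp only [this, Finset.sum_sub_distrib, Finset.sum_add_distrib, ← Finset.mul_sum,
      Finset.sum_const, Finset.card_univ, Fintype.card_fin, nsmul_eq_mul, ← Finset.sum_mul]
    ring
  have hlin : ∑ i : Fin m, ∑ j : Fin m, (SignType.sign ((i : ℤ) - (j : ℤ)) : ℤ) * (z i - z j)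
      = 2 * (2 * ∑ i : Fin m, ((i : ℤ) + 1) * z i - (m + 1) * ∑ i, z i) := by
    have h1 : ∑ i : Fin m, ∑ j : Fin m, (SignType.sign ((i : ℤ) - (j : ℤ)) : ℤ) * z i
        = 2 * ∑ i : Fin m, ((i : ℤ) + 1) * z i - (m + 1) * ∑ i, z i := by
      simp only [← Finset.sum_mul, sum_sign_sub]
      rw [Finset.mul_sum, Finset.mul_sum, ← Finset.sum_sub_distrib]
      exact Finset.sum_congr rfl fun i _ => by ring
    have h2 : ∑ i : Fin m, ∑ j : Fin m, (SignType.sign ((i : ℤ) - (j : ℤ)) : ℤ) * z j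
        = -∑ i : Fin m, ∑ j : Fin m, (SignType.sign ((i : ℤ) - (j : ℤ)) : ℤ) * z i := by
      rw [Finset.sum_comm, ← Finset.sum_neg_distrib]
      refine Finset.sum_congr rfl fun i _ => ?_
      rw [← Finset.sum_neg_distrib]
      refine Finset.sum_congr rfl fun j _ => ?_
      rw [← neg_sub (i : ℤ) (j : ℤ), Left.sign_neg]
      simp
    simp only [mul_sub, Finset.sum_sub_distrib, h2]
    rw [h1]; ring
  have hle : ∑ i : Fin m, ∑ j : Fin m, (SignType.sign ((i : ℤ) - (j : ℤ)) : ℤ) * (z i - z j)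
      ≤ ∑ i, ∑ j, (z i - z j) ^ 2 := by
    refine Finset.sum_le_sum fun i _ => Finset.sum_le_sum fun j _ => ?_
    have h1 := Int.abs_le_sq (z i - z j)
    have h2 := le_abs_self (z i - z j)
    have h3 := neg_abs_le (z i - z j)
    generalize SignType.sign ((i : ℤ) - (j : ℤ)) = s
    cases s <;> simp <;> nlinarith
  rw [hsq, hlin] at hle
  linarith

theorem sum_fin_add_one (m : ℕ) : ∑ i : Fin m, ((i : ℝ) + 1) = m * (m + 1) / 2 := by
  induction m with
  | zero => simp
  | succ m ih => rw [Fin.sum_univ_castSucc]; simp [ih]; ring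

theorem sum_perm_add_one {m : ℕ} (s : Equiv.Perm (Fin m)) :
    ∑ i, (((s i : ℕ) : ℝ) + 1) = m * (m + 1) / 2 := by
  rw [Equiv.sum_comp s fun i : Fin m => ((i : ℝ) + 1), sum_fin_add_one]

theorem convex_setOf_sum_mul_le {m : ℕ} (a : Fin m → ℝ) (r : ℝ) :
    Convex ℝ {x : Fin m → ℝ | ∑ i, a i * x i ≤ r} :=
  convex_halfSpace_le (f := fun x : Fin m → ℝ => ∑ i, a i * x i)
    ⟨fun x y => by simp [mul_add, Finset.sum_add_distrib],
      fun c x => by simp only [Pi.smul_apply, smul_eq_mul, Finset.mul_sum]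
                    exact Finset.sum_congr rfl fun i _ => by ring⟩ r

theorem sum_mul_le_of_mem_permutohedron {m : ℕ} {p : Fin m → ℝ} (hp : p ∈ permutohedron m)
    (a : Fin m → ℝ) {r : ℝ}
    (h : ∀ s : Equiv.Perm (Fin m), ∑ i, a i * (((s i : ℕ) : ℝ) + 1) ≤ r) :
    ∑ i, a i * p i ≤ r := by
  refine convexHull_min ?_ (convex_setOf_sum_mul_le a r) hp
  rintro _ ⟨s, rfl⟩
  exact h s

theorem sum_of_mem_permutohedron {m : ℕ} {p : Fin m → ℝ} (hp : p ∈ permutohedron m) :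
    ∑ i, p i = m * (m + 1) / 2 := by
  have h1 := sum_mul_le_of_mem_permutohedron hp (fun _ => 1) (r := m * (m + 1) / 2)
    fun s => by simp only [one_mul]; exact (sum_perm_add_one s).le
  have h2 := sum_mul_le_of_mem_permutohedron hp (fun _ => -1) (r := -(m * (m + 1) / 2 : ℝ))
    fun s => by
      simp only [neg_one_mul, Finset.sum_neg_distrib]; exact (neg_le_neg (sum_perm_add_one s).ge)
  simp only [one_mul, neg_one_mul, Finset.sum_neg_distrib] at h1 h2
  linarith

/-- Abel summation for a non-negative monotone sequence. -/
theorem sum_mul_nonpos_of_nonneg {m : ℕ} (b d : Fin m → ℝ) (hb : Monotone b) (h0 : ∀ i, 0 ≤ b i)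
    (hd : ∀ j, ∑ i ∈ Finset.Ici j, d i ≤ 0) : ∑ i, b i * d i ≤ 0 := by
  induction m with
  | zero => simp
  | succ m ih =>
    have htail : ∑ i : Fin m, (b i.succ - b 0) * d i.succ ≤ 0 := by
      refine ih (fun i => b i.succ - b 0) (fun i => d i.succ)
        (fun i j hij => sub_le_sub_right (hb (Fin.succ_le_succ_iff.2 hij)) _)
        (fun i => sub_nonneg.2 (hb (Fin.zero_le _))) fun j => ?_
      have := hd j.succ
      rwa [← Fin.map_succEmb_Ici, Finset.sum_map] at this
    have htot : ∑ i, d i ≤ 0 := by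
      have := hd 0
      rwa [show Finset.Ici (0 : Fin (m + 1)) = Finset.univ by
        ext i; simp] at this
    have : ∑ i, b i * d i = b 0 * ∑ i, d i + ∑ i : Fin m, (b i.succ - b 0) * d i.succ := by
      rw [Fin.sum_univ_succ, Fin.sum_univ_succ (f := d), mul_add, Finset.mul_sum, add_assoc,
        ← Finset.sum_add_distrib]
      congr 1
      exact Finset.sum_congr rfl fun i _ => by ring
    rw [this]
    have := mul_nonpos_of_nonneg_of_nonpos (h0 0) htot
    linarith

/-- As `d` has sum zero, `b` may be shifted by a constant; subtracting its first entry makes it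
non-negative. -/
theorem sum_mul_nonpos {m : ℕ} (b d : Fin m → ℝ) (hb : Monotone b) (htot : ∑ i, d i = 0)
    (hd : ∀ j, ∑ i ∈ Finset.Ici j, d i ≤ 0) : ∑ i, b i * d i ≤ 0 := by
  rcases m with _ | m
  · simp
  have := sum_mul_nonpos_of_nonneg (fun i => b i - b 0) d
    (fun i j hij => sub_le_sub_right (hb hij) _) (fun i => sub_nonneg.2 (hb (Fin.zero_le _))) hd
  simp only [sub_mul, Finset.sum_sub_distrib, ← Finset.mul_sum, htot] at this
  linarith

theorem sum_Ici_add_one {m : ℕ} (j : Fin m) :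
    ∑ i ∈ Finset.Ici j, ((i : ℝ) + 1) = ((m : ℝ) - j) * (m + 1 + j) / 2 := by
  have h : ∑ i ∈ Finset.Ici j, ((i : ℝ) + 1) = ∑ i ∈ Finset.Ico (j : ℕ) m, ((i : ℝ) + 1) := by
    have : Finset.Ico (j : ℕ) m = (Finset.Ici j).map Fin.valEmbedding := by
      ext k
      simp only [Finset.mem_Ico, Finset.mem_map, Finset.mem_Ici, Fin.valEmbedding_apply]
      exact ⟨fun hk => ⟨⟨k, hk.2⟩, hk.1, rfl⟩, fun ⟨i, hi, hik⟩ => hik ▸ ⟨hi, i.2⟩⟩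
    rw [this, Finset.sum_map]; rfl
  have hr : ∀ n : ℕ, ∑ i ∈ Finset.range n, ((i : ℝ) + 1) = n * (n + 1) / 2 := fun n => by
    rw [← sum_fin_add_one, Finset.sum_range]
  rw [h, Finset.sum_Ico_eq_sub _ j.2.le, hr, hr]
  ring

/-- Rado's theorem: the permutohedron is cut out by the inequalities that bound the partial sums of
the coordinates. -/
theorem mem_permutohedron_of_sum_le {m : ℕ} {p : Fin m → ℝ} (htot : ∑ i, p i = m * (m + 1) / 2)
    (h : ∀ S : Finset (Fin m), ∑ i ∈ S, p i ≤ S.card * (2 * m + 1 - S.card) / 2) :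
    p ∈ permutohedron m := by
  by_contra hp
  obtain ⟨f, u, hfu, hup⟩ := geometric_hahn_banach_closed_point (convex_convexHull ℝ _)
    ((Set.finite_range _).isCompact_convexHull ℝ).isClosed hp
  set a : Fin m → ℝ := fun i => f (Pi.single i 1) with ha
  have hf : ∀ x, f x = ∑ i, a i * x i := fun x => by
    conv_lhs => rw [← Finset.univ_sum_single x]
    rw [map_sum]
    refine Finset.sum_congr rfl fun i _ => ?_
    rw [ha, mul_comm, ← smul_eq_mul, ← map_smul, ← Pi.single_smul, smul_eq_mul, mul_one]
  -- The vertex `σ.symm` gives the larger coordinates to the larger coefficients of the separating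
  -- functional. Abel summation then shows that `f p` does not exceed the value of `f` there,
  -- contradicting the separation.
  set σ := Tuple.sort a
  have hs := hfu _ (subset_convexHull ℝ _ ⟨σ.symm, rfl⟩)
  have key : ∑ i, a (σ i) * (p (σ i) - ((i : ℝ) + 1)) ≤ 0 := by
    refine sum_mul_nonpos (a ∘ σ) _ (Tuple.monotone_sort a) ?_ fun j => ?_
    · rw [Finset.sum_sub_distrib, Equiv.sum_comp σ p, htot, sum_fin_add_one, sub_self]
    · rw [Finset.sum_sub_distrib, sum_Ici_add_one, sub_nonpos]
      have := h ((Finset.Ici j).map σ.toEmbedding)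
      rw [Finset.sum_map, Finset.card_map, Fin.card_Ici, Nat.cast_sub j.2.le] at this
      refine this.trans (le_of_eq ?_)
      ring
  simp only [mul_sub, Finset.sum_sub_distrib] at key
  rw [Equiv.sum_comp σ fun i => a i * p i, ← hf] at key
  rw [hf, ← Equiv.sum_comp σ] at hs
  simp only [Equiv.symm_apply_apply] at hs
  linarith

/-- The prism over the permutohedron, centred at the origin, is the Voronoi cell of the origin in
the lattice `m ℤ^m + ℤ (1, …, 1)`. -/
theorem forall_two_mul_sum_mul_le_iff {m : ℕ} (hm : 0 < m) (y : Fin m → ℝ) :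
    (∀ (z : Fin m → ℤ) (k : ℤ), 2 * ∑ i, y i * (m * z i + k) ≤ ∑ i, ((m : ℝ) * z i + k) ^ 2) ↔
      ∃ p ∈ permutohedron m, ∃ t ∈ Set.Icc (0 : ℝ) 1, ∀ i, y i = p i + t - (m + 2) / 2 := by
  have hm' : (0 : ℝ) < m := Nat.cast_pos.2 hm
  have hexp : ∀ (y : Fin m → ℝ) (z : Fin m → ℤ) (k : ℤ), ∑ i, y i * (m * z i + k)
      = m * ∑ i, z i * y i + k * ∑ i, y i := fun y z k => by
    rw [Finset.mul_sum, Finset.mul_sum, ← Finset.sum_add_distrib]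
    exact Finset.sum_congr rfl fun i _ => by ring
  have hexp2 : ∀ (z : Fin m → ℤ) (k : ℤ), ∑ i, ((m : ℝ) * z i + k) ^ 2
      = m ^ 2 * ∑ i, (z i : ℝ) ^ 2 + 2 * m * k * ∑ i, (z i : ℝ) + m * k ^ 2 := fun z k => by
    have : ∀ i, ((m : ℝ) * z i + k) ^ 2 = m ^ 2 * (z i : ℝ) ^ 2 + 2 * m * k * z i + k ^ 2 :=
      fun i => by ring
    simp [this, Finset.sum_add_distrib, ← Finset.mul_sum]
  constructor
  · intro h
    -- Points of the permutohedron have coordinate sum `m (m + 1) / 2`, so `t` is forced by the sum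
    -- of `y`. The lattice vectors `±(1, …, 1)` then give `0 ≤ t ≤ 1`.
    set t : ℝ := (∑ i, y i) / m + 1 / 2 with ht
    have hsum : ∑ i, y i = m * (t - 1 / 2) := by rw [ht]; field_simp; ring
    have h1 := h 0 1
    have h2 := h 0 (-1)
    rw [hexp, hexp2] at h1 h2
    simp only [Pi.zero_apply, Int.cast_zero, zero_mul, Finset.sum_const_zero, hsum] at h1 h2
    norm_num at h1 h2
    refine ⟨fun i => y i - t + (m + 2) / 2, mem_permutohedron_of_sum_le ?_ fun S => ?_, t,
      ⟨?_, ?_⟩, fun i => by ring⟩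
    · simp only [Finset.sum_add_distrib, Finset.sum_sub_distrib, hsum]
      simp
      ring
    · classical
      -- The lattice vector `m 1_S - |S| (1, …, 1)` is orthogonal to the diagonal and yields Rado's
      -- inequality for `S`.
      have h3 := h (fun i => if i ∈ S then 1 else 0) (-S.card)
      rw [hexp, hexp2, hsum] at h3
      have hr : (∑ i, (((if i ∈ S then 1 else 0 : ℤ)) : ℝ)) = S.card := by simp
      have hr2 : (∑ i, (((if i ∈ S then 1 else 0 : ℤ)) : ℝ) ^ 2) = S.card := by simp
      have hr3 : (∑ i, (((if i ∈ S then 1 else 0 : ℤ)) : ℝ) * y i) = ∑ i ∈ S, y i := by simp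
      rw [hr, hr2, hr3] at h3
      push_cast at h3
      simp only [Finset.sum_add_distrib, Finset.sum_sub_distrib, Finset.sum_const, nsmul_eq_mul]
      nlinarith
    · nlinarith
    · nlinarith
  · rintro ⟨p, hp, t, ⟨ht0, ht1⟩, hy⟩ z k
    have hsum : ∑ i, y i = m * (t - 1 / 2) := by
      simp only [hy, Finset.sum_add_distrib, Finset.sum_sub_distrib, sum_of_mem_permutohedron hp]
      simp
      ring
    have hzy : ∑ i, (z i : ℝ) * y i
        = ∑ i, (z i : ℝ) * p i + (t - (m + 2) / 2) * ∑ i, (z i : ℝ) := by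
      rw [Finset.mul_sum, ← Finset.sum_add_distrib]
      exact Finset.sum_congr rfl fun i _ => by rw [hy]; ring
    -- At the vertex `s` this is the discrete inequality for `z ∘ s⁻¹`; being linear in `p`, it
    -- extends to the convex hull.
    have hzp : ∑ i, (z i : ℝ) * p i ≤ ((m + 1) * ∑ i, (z i : ℝ) + m * ∑ i, (z i : ℝ) ^ 2
        - (∑ i, (z i : ℝ)) ^ 2) / 2 := by
      refine sum_mul_le_of_mem_permutohedron hp _ fun s => ?_
      have := two_mul_sum_mul_le (z ∘ s.symm)
      have e1 : ∑ i, (z ∘ s.symm) i = ∑ i, z i := Equiv.sum_comp s.symm z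
      have e2 : ∑ i, (z ∘ s.symm) i ^ 2 = ∑ i, z i ^ 2 :=
        Equiv.sum_comp s.symm fun i => z i ^ 2
      have e3 : ∑ i : Fin m, ((i : ℤ) + 1) * (z ∘ s.symm) i = ∑ i, (((s i : ℕ) : ℤ) + 1) * z i := by
        rw [← Equiv.sum_comp s]; simp
      rw [e1, e2, e3] at this
      have hR : (2 : ℝ) * ∑ i, (((s i : ℕ) : ℝ) + 1) * z i - (m + 1) * ∑ i, (z i : ℝ)
        ≤ m * ∑ i, (z i : ℝ) ^ 2 - (∑ i, (z i : ℝ)) ^ 2 := by exact_mod_cast this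
      simp only [mul_comm (z _ : ℝ)]
      linarith
    rw [hexp, hexp2, hzy, hsum]
    set Z := ∑ i, (z i : ℝ) with hZ
    -- The diagonal part: `Z + k` is an integer and `|2 t - 1| ≤ 1`. The claim is `m` times the sum
    -- of this and twice `hzp`.
    have hint : (2 * t - 1) * (Z + k) ≤ (Z + k) ^ 2 := by
      have hc : Z + k = ((∑ i, z i + k : ℤ) : ℝ) := by push_cast; rfl
      have h1 : |Z + k| ≤ (Z + k) ^ 2 := by rw [hc]; exact_mod_cast Int.abs_le_sq _
      have h2 : |(2 * t - 1) * (Z + k)| ≤ |Z + k| := by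
        rw [abs_mul]
        exact mul_le_of_le_one_left (abs_nonneg _) (abs_le.2 ⟨by linarith, by linarith⟩)
      exact (le_abs_self _).trans (h2.trans h1)
    have h1 := mul_le_mul_of_nonneg_left hzp hm'.le
    have h2 := mul_le_mul_of_nonneg_left hint hm'.le
    nlinarith

end Permutohedron

/-! ### Positions and coordinates along the cycles -/

section Cycles

variable {V : Type*} (τ : Equiv.Perm V)

theorem cycleThrough_eq_iff {u v : V} : cycleThrough τ u = cycleThrough τ v ↔ τ.SameCycle u v :=
  Quotient.eq (r := Equiv.Perm.SameCycle.setoid τ)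

@[simp]
theorem cycleThrough_zpow_apply (j : ℤ) (v : V) :
    cycleThrough τ ((τ ^ j) v) = cycleThrough τ v :=
  (cycleThrough_eq_iff τ).2 (Equiv.Perm.sameCycle_zpow_left.2 (Equiv.Perm.SameCycle.refl τ v))

theorem cycleThrough_out (c : Cycles τ) : cycleThrough τ c.out = c := Quotient.out_eq c

theorem exists_zpow_out (v : V) : ∃ j : ℤ, (τ ^ j) (cycleThrough τ v).out = v :=
  (cycleThrough_eq_iff τ).1 (cycleThrough_out τ (cycleThrough τ v))

/-- The position of `v` in its cycle, counted from a base point: an integer that matters only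
modulo the length of the cycle. -/
noncomputable def cyclePos (v : V) : ℤ := (exists_zpow_out τ v).choose

theorem zpow_cyclePos (v : V) : (τ ^ cyclePos τ v) (cycleThrough τ v).out = v :=
  (exists_zpow_out τ v).choose_spec

theorem zpow_apply_self_eq (j : ℤ) (v : V) :
    (τ ^ j) v = (τ ^ (j + cyclePos τ v)) (cycleThrough τ v).out := by
  rw [zpow_add, Equiv.Perm.mul_apply, zpow_cyclePos]

section Finite

variable [Finite V]

theorem cycleLength_pos (v : V) : 0 < cycleLength τ (cycleThrough τ v) :=
  Nat.card_pos_iff.2 ⟨⟨⟨v, rfl⟩⟩, inferInstance⟩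

theorem cycleLength_pos' (c : Cycles τ) : 0 < cycleLength τ c :=
  cycleThrough_out τ c ▸ cycleLength_pos τ c.out

/-- The cycle of `v` is its orbit under the powers of `τ`, whose size is the minimal period. -/
theorem zpow_apply_eq_self_iff (j : ℤ) (v : V) :
    (τ ^ j) v = v ↔ (cycleLength τ (cycleThrough τ v) : ℤ) ∣ j := by
  have := Fintype.ofFinite (MulAction.orbit (Subgroup.zpowers τ) v)
  have h1 := MulAction.zpow_smul_eq_iff_minimalPeriod_dvd (a := τ) (b := v) (n := j)
  rw [MulAction.minimalPeriod_eq_card, ← Nat.card_eq_fintype_card] at h1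
  have h2 : cycleLength τ (cycleThrough τ v)
      = Nat.card (MulAction.orbit (Subgroup.zpowers τ) v) := by
    refine Nat.card_congr (Equiv.subtypeEquivRight fun u => ?_)
    rw [eq_comm, cycleThrough_eq_iff, MulAction.mem_orbit_iff]
    constructor
    · rintro ⟨i, hi⟩
      exact ⟨⟨τ ^ i, i, rfl⟩, hi⟩
    · rintro ⟨⟨_, i, rfl⟩, hi⟩
      exact ⟨i, hi⟩
  rw [h2]
  exact h1

theorem zpow_out_eq_iff (j k : ℤ) (c : Cycles τ) :
    (τ ^ j) c.out = (τ ^ k) c.out ↔ (cycleLength τ c : ℤ) ∣ j - k := by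
  have h := zpow_apply_eq_self_iff τ (j - k) c.out
  rw [cycleThrough_out] at h
  rw [← h, sub_eq_neg_add, zpow_add, zpow_neg, Equiv.Perm.mul_apply, Equiv.Perm.inv_eq_iff_eq,
    eq_comm]

/-- The element number `i` of the cycle `c`. -/
noncomputable def cycleElem (c : Cycles τ) (i : Fin (cycleLength τ c)) : V :=
  ((cycleNumbering τ c).symm i).1

@[simp]
theorem cycleThrough_cycleElem (c : Cycles τ) (i : Fin (cycleLength τ c)) :
    cycleThrough τ (cycleElem τ c i) = c :=
  ((cycleNumbering τ c).symm i).2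

theorem cycleElem_injective (c : Cycles τ) : Function.Injective (cycleElem τ c) :=
  Subtype.val_injective.comp (cycleNumbering τ c).symm.injective

theorem exists_eq_cycleElem (v : V) : ∃ c i, v = cycleElem τ c i :=
  ⟨cycleThrough τ v, cycleNumbering τ _ ⟨v, rfl⟩, by simp [cycleElem]⟩

/-- The map on `V` that is given by `f c` on the numbers of the elements of the cycle `c`. -/
noncomputable def glueCycles {α : Type*} (f : (c : Cycles τ) → Fin (cycleLength τ c) → α) (v : V) :
    α :=
  f (cycleThrough τ v) (cycleNumbering τ (cycleThrough τ v) ⟨v, rfl⟩)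

@[simp]
theorem glueCycles_cycleElem {α : Type*} (f : (c : Cycles τ) → Fin (cycleLength τ c) → α)
    (c : Cycles τ) (i : Fin (cycleLength τ c)) : glueCycles τ f (cycleElem τ c i) = f c i := by
  have : ∀ v : CycleElems τ c, glueCycles τ f v = f c (cycleNumbering τ c v) := by
    rintro ⟨v, rfl⟩; rfl
  rw [cycleElem, this, Equiv.apply_symm_apply]

theorem sum_cycleElem {M : Type*} [AddCommMonoid M] [Fintype V] [Fintype (Cycles τ)] (f : V → M) :
    ∑ v, f v = ∑ c, ∑ i, f (cycleElem τ c i) := by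
  have h : Function.Bijective fun p : Σ c, Fin (cycleLength τ c) => cycleElem τ p.1 p.2 := by
    constructor
    · rintro ⟨c, i⟩ ⟨d, j⟩ hij
      have hcd := congrArg (cycleThrough τ) hij
      simp only [cycleThrough_cycleElem] at hcd
      subst hcd
      exact congrArg _ (cycleElem_injective τ c hij)
    · intro v
      obtain ⟨c, i, rfl⟩ := exists_eq_cycleElem τ v
      exact ⟨⟨c, i⟩, rfl⟩
  rw [← h.sum_comp, Fintype.sum_sigma]

end Finite

end Cycles

/-! ### Invertible elements and the structure of their group -/

section Invertible

variable {V : Type*} {τ : Equiv.Perm V}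

namespace TwistedMap

/-- The self-map `v ↦ v · φ(v)` of `V`. -/
def move (φ : TwistedMap τ) (v : V) : V := (τ ^ φ.toFun v) v

@[simp]
theorem toFun_one (v : V) : (1 : TwistedMap τ).toFun v = 0 := rfl

@[simp]
theorem toFun_mul (φ ψ : TwistedMap τ) (v : V) :
    (φ * ψ).toFun v = φ.toFun v + ψ.toFun (φ.move v) := rfl

@[simp]
theorem move_one (v : V) : (1 : TwistedMap τ).move v = v := by simp [move]

@[simp]
theorem move_mul (φ ψ : TwistedMap τ) (v : V) : (φ * ψ).move v = ψ.move (φ.move v) := by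
  rw [move, toFun_mul, add_comm, zpow_add]; rfl

@[simp]
theorem cycleThrough_move (φ : TwistedMap τ) (v : V) :
    cycleThrough τ (φ.move v) = cycleThrough τ v := cycleThrough_zpow_apply τ _ v

/-- By `move_mul`, an inverse of `φ` undoes `move`. Conversely, an injective `move` is a permutation
`σ` of the finite set `V`, and the inverse must be `v ↦ -φ(σ⁻¹ v)`. -/
theorem isUnit_iff [Finite V] (φ : TwistedMap τ) : IsUnit φ ↔ Function.Injective φ.move := by
  constructor
  · rintro ⟨u, rfl⟩
    refine Function.LeftInverse.injective (g := (↑u⁻¹ : TwistedMap τ).move) fun v => ?_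
    rw [← move_mul, u.mul_inv, move_one]
  · intro h
    let σ := Equiv.ofBijective _ (Finite.injective_iff_bijective.1 h)
    have hσ : ∀ v, φ.move v = σ v := fun v => rfl
    refine ⟨⟨φ, ⟨fun v => -φ.toFun (σ.symm v)⟩, TwistedMap.ext (funext fun v => ?_),
      TwistedMap.ext (funext fun v => ?_)⟩, rfl⟩
    · simp [hσ]
    · obtain ⟨u, rfl⟩ := σ.surjective v
      have : (τ ^ (-φ.toFun u)) (σ u) = u := by
        rw [← hσ, move, ← Equiv.Perm.mul_apply, ← zpow_add]; simp
      rw [toFun_mul, move]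
      simp only [Equiv.symm_apply_apply, this, toFun_one, neg_add_cancel]

theorem dvd_cyclePos_sub [Finite V] (φ : TwistedMap τ) (v : V) :
    (cycleLength τ (cycleThrough τ v) : ℤ) ∣ φ.toFun v + cyclePos τ v - cyclePos τ (φ.move v) := by
  rw [← zpow_out_eq_iff, ← zpow_apply_self_eq, ← cycleThrough_move φ, zpow_cyclePos, move]

theorem move_cycleElem_eq_iff [Finite V] (φ : TwistedMap τ) (c : Cycles τ)
    (i : Fin (cycleLength τ c)) (u : V) (hu : cycleThrough τ u = c) :
    φ.move (cycleElem τ c i) = u ↔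
      (cycleLength τ c : ℤ) ∣ φ.toFun (cycleElem τ c i) + cyclePos τ (cycleElem τ c i)
        - cyclePos τ u := by
  subst hu
  rw [← zpow_out_eq_iff, zpow_cyclePos, move, zpow_apply_self_eq, cycleThrough_cycleElem]

/-- The invertible maps are those that take, up to the positions and an integer, each residue
modulo the length of a cycle once on this cycle. -/
theorem isUnit_of_eq [Finite V] (φ : TwistedMap τ)
    (s : (c : Cycles τ) → Equiv.Perm (Fin (cycleLength τ c))) (z : V → ℤ) (k : Cycles τ → ℤ)
    (h : ∀ c i, φ.toFun (cycleElem τ c i) = (s c i : ℕ) + 1 - cyclePos τ (cycleElem τ c i)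
      + cycleLength τ c * z (cycleElem τ c i) + k c) : IsUnit φ := by
  rw [isUnit_iff]
  intro u v huv
  obtain ⟨c, i, rfl⟩ := exists_eq_cycleElem τ u
  obtain ⟨d, j, rfl⟩ := exists_eq_cycleElem τ v
  have hcd := congrArg (cycleThrough τ) huv
  simp only [cycleThrough_move, cycleThrough_cycleElem] at hcd
  subst hcd
  rw [move, move, zpow_apply_self_eq, zpow_apply_self_eq τ _ (cycleElem τ c j),
    cycleThrough_cycleElem, cycleThrough_cycleElem, zpow_out_eq_iff, h, h] at huv
  -- The shift `k c` is common to the whole cycle and cancels; the `z` terms vanish modulo the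
  -- length.
  have h1 : (cycleLength τ c : ℤ) ∣ (s c i : ℕ) - (s c j : ℕ) := by
    obtain ⟨q, hq⟩ := huv
    exact ⟨q - z (cycleElem τ c i) + z (cycleElem τ c j), by linarith⟩
  have h2 := Int.eq_zero_of_abs_lt_dvd h1 (abs_lt.2 ⟨by omega, by omega⟩)
  have h3 : s c i = s c j := Fin.ext (by omega)
  rw [(s c).injective h3]

theorem exists_eq_of_isUnit [Finite V] {φ : TwistedMap τ} (hφ : IsUnit φ) :
    ∃ (s : (c : Cycles τ) → Equiv.Perm (Fin (cycleLength τ c))) (z : V → ℤ),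
      ∀ c i, φ.toFun (cycleElem τ c i) = (s c i : ℕ) + 1 - cyclePos τ (cycleElem τ c i)
        + cycleLength τ c * z (cycleElem τ c i) := by
  rw [isUnit_iff] at hφ
  -- The `- 1` matches permutations of `0, …, m - 1` with coordinates `1, …, m`. Remainders of `r`
  -- give `s`, quotients give `z`.
  set r : V → ℤ := fun v => φ.toFun v + cyclePos τ v - 1 with hr
  have hm : ∀ c, (0 : ℤ) < cycleLength τ c := fun c => by exact_mod_cast cycleLength_pos' τ c
  let t : (c : Cycles τ) → Fin (cycleLength τ c) → Fin (cycleLength τ c) := fun c i =>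
    ⟨(r (cycleElem τ c i) % cycleLength τ c).toNat, by
      have := Int.emod_lt_of_pos (r (cycleElem τ c i)) (hm c)
      have := Int.emod_nonneg (r (cycleElem τ c i)) (hm c).ne'
      omega⟩
  have ht : ∀ c i, ((t c i : ℕ) : ℤ) = r (cycleElem τ c i) % cycleLength τ c := fun c i =>
    Int.toNat_of_nonneg (Int.emod_nonneg _ (hm c).ne')
  have hinj : ∀ c, Function.Injective (t c) := by
    intro c i j hij
    refine cycleElem_injective τ c (hφ ?_)
    have h1 : r (cycleElem τ c i) % cycleLength τ c = r (cycleElem τ c j) % cycleLength τ c := by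
      rw [← ht, ← ht, hij]
    rw [move, move, zpow_apply_self_eq, zpow_apply_self_eq τ _ (cycleElem τ c j),
      cycleThrough_cycleElem, cycleThrough_cycleElem, zpow_out_eq_iff]
    have h2 := Int.ModEq.dvd (show r (cycleElem τ c j) ≡ r (cycleElem τ c i) [ZMOD _] from h1.symm)
    simpa [hr] using h2
  refine ⟨fun c => Equiv.ofBijective (t c) (Finite.injective_iff_bijective.1 (hinj c)),
    fun v => r v / cycleLength τ (cycleThrough τ v), fun c i => ?_⟩
  have := Int.emod_add_mul_ediv (r (cycleElem τ c i)) (cycleLength τ c)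
  rw [Equiv.ofBijective_apply, ht]
  simp only [cycleThrough_cycleElem]
  simp only [hr] at this ⊢
  linarith

end TwistedMap

open TwistedMap

/-- The action of the invertible elements on `V`, by permutations that preserve the cycles. -/
def unitsMove (τ : Equiv.Perm V) : InvertibleGroup τ →* Equiv.Perm V where
  toFun φ :=
    -- `move` reverses products, so the inverse is needed to obtain a homomorphism.
    { toFun := (↑φ⁻¹ : TwistedMap τ).move
      invFun := (φ : TwistedMap τ).move
      left_inv := fun v => by rw [← move_mul, φ.inv_mul, move_one]
      right_inv := fun v => by rw [← move_mul, φ.mul_inv, move_one] }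
  map_one' := by ext v; simp
  map_mul' φ ψ := by ext v; simp

variable [Finite V]

/-- The action of the invertible elements on the numbers of the elements of the cycle `c`. -/
noncomputable def cycleMove (τ : Equiv.Perm V) (c : Cycles τ) (φ : InvertibleGroup τ) :
    Equiv.Perm (Fin (cycleLength τ c)) :=
  (cycleNumbering τ c).permCongr ((unitsMove τ φ).subtypePerm
    fun v => by rw [show unitsMove τ φ v = (↑φ⁻¹ : TwistedMap τ).move v from rfl, cycleThrough_move])

theorem cycleElem_cycleMove_symm (c : Cycles τ) (φ : InvertibleGroup τ)
    (i : Fin (cycleLength τ c)) :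
    cycleElem τ c ((cycleMove τ c φ).symm i) = (φ : TwistedMap τ).move (cycleElem τ c i) := by
  have : (cycleMove τ c φ).symm i = cycleNumbering τ c
      ⟨(φ : TwistedMap τ).move (cycleElem τ c i), by simp⟩ := rfl
  rw [this, cycleElem, Equiv.symm_apply_apply]

/-- The number of turns that an invertible element makes around the cycle, starting from `v`. -/
noncomputable def windingNumber (φ : TwistedMap τ) (v : V) : ℤ :=
  (φ.toFun v + cyclePos τ v - cyclePos τ (φ.move v)) / cycleLength τ (cycleThrough τ v)

theorem cycleLength_mul_windingNumber (φ : TwistedMap τ) (v : V) :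
    cycleLength τ (cycleThrough τ v) * windingNumber φ v
      = φ.toFun v + cyclePos τ v - cyclePos τ (φ.move v) :=
  Int.mul_ediv_cancel' (φ.dvd_cyclePos_sub v)

/-- The positions telescope. This cocycle rule is the law of the lattice component in the semidirect
product. -/
theorem windingNumber_mul (φ ψ : TwistedMap τ) (v : V) :
    windingNumber (φ * ψ) v = windingNumber φ v + windingNumber ψ (φ.move v) := by
  have hm : (cycleLength τ (cycleThrough τ v) : ℤ) ≠ 0 := by
    exact_mod_cast (cycleLength_pos τ v).ne'
  have h := cycleLength_mul_windingNumber ψ (φ.move v)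
  rw [cycleThrough_move] at h
  refine mul_left_cancel₀ hm ?_
  rw [mul_add, h, cycleLength_mul_windingNumber, cycleLength_mul_windingNumber, toFun_mul, move_mul]
  ring

/-- The homomorphism that records the winding numbers and the permutations of the cycles. -/
noncomputable def toLatticeSemidirect (τ : Equiv.Perm V) :
    InvertibleGroup τ →* ((c : Cycles τ) → LatticeSemidirect (cycleLength τ c)) :=
  MonoidHom.mk' (fun φ c => ⟨fun i => Multiplicative.ofAdd
      (windingNumber (φ : TwistedMap τ) (cycleElem τ c i)), cycleMove τ c φ⟩) <| by
    intro φ ψ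
    funext c
    refine SemidirectProduct.ext (funext fun i => ?_) ?_
    · change Multiplicative.ofAdd (windingNumber ((φ : TwistedMap τ) * (ψ : TwistedMap τ)) (cycleElem τ c i))
        = Multiplicative.ofAdd (windingNumber (φ : TwistedMap τ) (cycleElem τ c i)
          + windingNumber (ψ : TwistedMap τ) (cycleElem τ c ((cycleMove τ c φ).symm i)))
      rw [cycleElem_cycleMove_symm, windingNumber_mul]
    · refine Equiv.symm_bijective.injective (Equiv.ext fun i => cycleElem_injective τ c ?_)
      change cycleElem τ c ((cycleMove τ c (φ * ψ)).symm i)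
        = cycleElem τ c ((cycleMove τ c ψ).symm ((cycleMove τ c φ).symm i))
      rw [cycleElem_cycleMove_symm, cycleElem_cycleMove_symm, cycleElem_cycleMove_symm,
        Units.val_mul, move_mul]

/-- The winding number at `v` and the target `φ.move v` determine `φ(v)`. -/
theorem toLatticeSemidirect_injective (τ : Equiv.Perm V) :
    Function.Injective (toLatticeSemidirect τ) := by
  intro φ ψ h
  refine Units.ext (TwistedMap.ext (funext fun v => ?_))
  obtain ⟨c, i, rfl⟩ := exists_eq_cycleElem τ v
  have hc := congrFun h c
  have h1 : windingNumber (φ : TwistedMap τ) (cycleElem τ c i)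
      = windingNumber (ψ : TwistedMap τ) (cycleElem τ c i) :=
    congrFun (congrArg SemidirectProduct.left hc) i
  have h2 : cycleMove τ c φ = cycleMove τ c ψ := congrArg SemidirectProduct.right hc
  have h3 := cycleElem_cycleMove_symm c φ i
  rw [h2, cycleElem_cycleMove_symm] at h3
  have h4 := cycleLength_mul_windingNumber (φ : TwistedMap τ) (cycleElem τ c i)
  rw [h1, cycleLength_mul_windingNumber, h3] at h4
  linarith

theorem toLatticeSemidirect_surjective (τ : Equiv.Perm V) :
    Function.Surjective (toLatticeSemidirect τ) := by
  intro f
  -- The defining relation of the winding number, solved for `φ` with prescribed targets and winding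
  -- numbers.
  let φ : TwistedMap τ := ⟨glueCycles τ fun c i => cyclePos τ (cycleElem τ c ((f c).right.symm i))
    - cyclePos τ (cycleElem τ c i) + cycleLength τ c * Multiplicative.toAdd ((f c).left i)⟩
  have hφ : ∀ c i, φ.toFun (cycleElem τ c i) = cyclePos τ (cycleElem τ c ((f c).right.symm i))
      - cyclePos τ (cycleElem τ c i) + cycleLength τ c * Multiplicative.toAdd ((f c).left i) :=
    fun c i => glueCycles_cycleElem τ (fun c i => cyclePos τ (cycleElem τ c ((f c).right.symm i))
      - cyclePos τ (cycleElem τ c i) + cycleLength τ c * Multiplicative.toAdd ((f c).left i)) c i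
  have hmove : ∀ c i, φ.move (cycleElem τ c i) = cycleElem τ c ((f c).right.symm i) := by
    intro c i
    rw [move_cycleElem_eq_iff _ _ _ _ (cycleThrough_cycleElem τ c _), hφ]
    exact ⟨Multiplicative.toAdd ((f c).left i), by ring⟩
  have hunit : IsUnit φ := by
    rw [isUnit_iff]
    intro u v huv
    obtain ⟨c, i, rfl⟩ := exists_eq_cycleElem τ u
    obtain ⟨d, j, rfl⟩ := exists_eq_cycleElem τ v
    have hcd := congrArg (cycleThrough τ) huv
    simp only [cycleThrough_move, cycleThrough_cycleElem] at hcd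
    subst hcd
    rw [hmove, hmove] at huv
    rw [(f c).right.symm.injective (cycleElem_injective τ c huv)]
  obtain ⟨u, hu⟩ := hunit
  refine ⟨u, funext fun c => SemidirectProduct.ext (funext fun i => ?_) ?_⟩
  · change Multiplicative.ofAdd (windingNumber (u : TwistedMap τ) (cycleElem τ c i)) = _
    have hm : (cycleLength τ c : ℤ) ≠ 0 := by
      exact_mod_cast (cycleLength_pos' τ c).ne'
    have h := cycleLength_mul_windingNumber φ (cycleElem τ c i)
    rw [cycleThrough_cycleElem, hmove, hφ] at h
    rw [hu, ← ofAdd_toAdd ((f c).left i)]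
    exact congrArg _ (mul_left_cancel₀ hm (by rw [h]; ring))
  · refine Equiv.symm_bijective.injective (Equiv.ext fun i => cycleElem_injective τ c ?_)
    exact (cycleElem_cycleMove_symm c u i).trans (by rw [hu, hmove])

end Invertible

/-! ### Vertices of the permutohedron and of affine images -/

section ExtremePoints

/-- Injectivity on `S` suffices because segments between points of `S` stay in `S`. The placing
maps, which go from dimension `n + k` to `n`, are injective only there. -/
theorem extremePoints_image_of_injOn {E F : Type*} [AddCommGroup E] [Module ℝ E] [AddCommGroup F]
    [Module ℝ F] (f : E →ᵃ[ℝ] F) {S : Set E} (hS : Convex ℝ S) (hf : Set.InjOn f S) :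
    Set.extremePoints ℝ (f '' S) = f '' Set.extremePoints ℝ S := by
  ext y
  simp only [mem_extremePoints_iff_left, Set.mem_image]
  constructor
  · rintro ⟨⟨x, hx, rfl⟩, h⟩
    refine ⟨x, ⟨hx, fun x₁ h₁ x₂ h₂ hseg => hf h₁ hx ?_⟩, rfl⟩
    exact h _ ⟨x₁, h₁, rfl⟩ _ ⟨x₂, h₂, rfl⟩ (image_openSegment ℝ f x₁ x₂ ▸ ⟨x, hseg, rfl⟩)
  · rintro ⟨x, ⟨hx, h⟩, rfl⟩
    refine ⟨⟨x, hx, rfl⟩, ?_⟩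
    rintro _ ⟨x₁, h₁, rfl⟩ _ ⟨x₂, h₂, rfl⟩ hseg
    rw [← image_openSegment ℝ f] at hseg
    obtain ⟨x', hx', hfx⟩ := hseg
    rw [← hf (hS.openSegment_subset h₁ h₂ hx') hx hfx] at h ⊢
    rw [h x₁ h₁ x₂ h₂ hx']

theorem extremePoints_unitInterval : Set.extremePoints ℝ (Set.Icc (0 : ℝ) 1) = {0, 1} := by
  refine Set.Subset.antisymm ?_ ?_
  · rw [← segment_eq_Icc zero_le_one, ← convexHull_pair]
    exact extremePoints_convexHull_subset
  · rintro x hx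
    rw [mem_extremePoints_iff_left]
    rcases hx with rfl | rfl
    · refine ⟨by simp, ?_⟩
      rintro x₁ h₁ x₂ h₂ ⟨a, b, ha, hb, hab, h⟩
      simp only [smul_eq_mul] at h
      nlinarith [h₁.1, h₂.1, mul_nonneg ha.le h₁.1, mul_nonneg hb.le h₂.1]
    · refine ⟨by simp, ?_⟩
      rintro x₁ h₁ x₂ h₂ ⟨a, b, ha, hb, hab, h⟩
      simp only [smul_eq_mul] at h
      nlinarith [h₁.2, h₂.2, mul_nonneg ha.le (sub_nonneg.2 h₁.2),
        mul_nonneg hb.le (sub_nonneg.2 h₂.2)]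

theorem sum_sq_combo {ι : Type*} [Fintype ι] (x y : ι → ℝ) {a b : ℝ} (hab : a + b = 1) :
    ∑ i, (a • x + b • y) i ^ 2
      = a * ∑ i, x i ^ 2 + b * ∑ i, y i ^ 2 - a * b * ∑ i, (x i - y i) ^ 2 := by
  rw [Finset.mul_sum, Finset.mul_sum, Finset.mul_sum, ← Finset.sum_add_distrib,
    ← Finset.sum_sub_distrib]
  refine Finset.sum_congr rfl fun i _ => ?_
  obtain rfl : b = 1 - a := by linarith
  simp only [Pi.add_apply, Pi.smul_apply, smul_eq_mul]
  ring

theorem sum_sq_le_of_mem_permutohedron {m : ℕ} {p : Fin m → ℝ} (hp : p ∈ permutohedron m) :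
    ∑ i, p i ^ 2 ≤ ∑ i : Fin m, ((i : ℝ) + 1) ^ 2 := by
  refine convexHull_min (t := {p : Fin m → ℝ | ∑ i, p i ^ 2 ≤ ∑ i : Fin m, ((i : ℝ) + 1) ^ 2})
    ?_ ?_ hp
  · rintro _ ⟨s, rfl⟩
    exact (Equiv.sum_comp s fun i : Fin m => ((i : ℝ) + 1) ^ 2).le
  · intro x hx y hy a b ha hb hab
    rw [Set.mem_ofPred_eq] at *
    rw [sum_sq_combo x y hab]
    have h1 := mul_le_mul_of_nonneg_left hx ha
    have h2 := mul_le_mul_of_nonneg_left hy hb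
    have h3 : 0 ≤ a * b * ∑ i, (x i - y i) ^ 2 :=
      mul_nonneg (mul_nonneg ha hb) (Finset.sum_nonneg fun i _ => sq_nonneg _)
    have h4 : a * ∑ i : Fin m, ((i : ℝ) + 1) ^ 2 + b * ∑ i : Fin m, ((i : ℝ) + 1) ^ 2
        = ∑ i : Fin m, ((i : ℝ) + 1) ^ 2 := by rw [← add_mul, hab, one_mul]
    linarith

/-- All the generating points lie on one sphere around the origin, and the ball it bounds is
strictly convex (`sum_sq_combo`), so none lies inside a proper segment of the hull. -/
theorem extremePoints_permutohedron (m : ℕ) : Set.extremePoints ℝ (permutohedron m)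
    = Set.range fun (s : Equiv.Perm (Fin m)) (i : Fin m) => ((s i : ℕ) : ℝ) + 1 := by
  refine Set.Subset.antisymm extremePoints_convexHull_subset ?_
  rintro _ ⟨s, rfl⟩
  rw [mem_extremePoints_iff_left]
  refine ⟨subset_convexHull _ _ ⟨s, rfl⟩, ?_⟩
  rintro x hx y hy ⟨a, b, ha, hb, hab, h⟩
  have h0 : ∑ i, (((s i : ℕ) : ℝ) + 1) ^ 2 = ∑ i : Fin m, ((i : ℝ) + 1) ^ 2 :=
    Equiv.sum_comp s fun i : Fin m => ((i : ℝ) + 1) ^ 2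
  have hN := sum_sq_combo x y hab
  rw [h, h0] at hN
  have h1 := mul_le_mul_of_nonneg_left (sum_sq_le_of_mem_permutohedron hx) ha.le
  have h2 := mul_le_mul_of_nonneg_left (sum_sq_le_of_mem_permutohedron hy) hb.le
  have h4 : a * ∑ i : Fin m, ((i : ℝ) + 1) ^ 2 + b * ∑ i : Fin m, ((i : ℝ) + 1) ^ 2
      = ∑ i : Fin m, ((i : ℝ) + 1) ^ 2 := by rw [← add_mul, hab, one_mul]
  have h3 : a * b * ∑ i, (x i - y i) ^ 2 ≤ 0 := by linarith
  have h5 : ∑ i, (x i - y i) ^ 2 ≤ 0 := nonpos_of_mul_nonpos_right h3 (mul_pos ha hb)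
  have h6 := (Finset.sum_eq_zero_iff_of_nonneg fun i _ => sq_nonneg _).1
    (h5.antisymm (Finset.sum_nonneg fun i _ => sq_nonneg _))
  have hxy : x = y := funext fun i =>
    sub_eq_zero.1 (pow_eq_zero_iff two_ne_zero |>.1 (h6 i (Finset.mem_univ i)))
  rw [← h, ← hxy, ← add_smul, hab, one_smul]

end ExtremePoints

theorem le_of_mem_permutohedron {m : ℕ} {p : Fin m → ℝ} (hp : p ∈ permutohedron m) (i : Fin m) :
    0 ≤ p i ∧ p i ≤ m := by
  have h1 := sum_mul_le_of_mem_permutohedron hp (Pi.single i 1) (r := m) fun s => by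
    have : (s i : ℕ) + 1 ≤ m := (s i).2
    simpa [Pi.single_apply] using (by exact_mod_cast this : ((s i : ℕ) : ℝ) + 1 ≤ m)
  have h2 := sum_mul_le_of_mem_permutohedron hp (Pi.single i (-1)) (r := 0) fun s => by
    have : (-1 : ℝ) ≤ ((s i : ℕ) : ℝ) := by linarith [Nat.cast_nonneg (α := ℝ) (s i : ℕ)]
    simpa [Pi.single_apply] using this
  exact ⟨by simpa [Pi.single_apply] using h2, by simpa [Pi.single_apply] using h1⟩

/-! ### The tiles and their vertices -/

section Tiles

variable {V : Type*} [Finite V] (τ : Equiv.Perm V)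

@[simp]
theorem placeProd_cycleElem (w : V → ℝ)
    (p : ((c : Cycles τ) → Fin (cycleLength τ c) → ℝ) × (Cycles τ → ℝ)) (c : Cycles τ)
    (i : Fin (cycleLength τ c)) :
    placeProd τ w p (cycleElem τ c i) = p.1 c i + p.2 c + w (cycleElem τ c i) := by
  change glueCycles τ p.1 (cycleElem τ c i) + p.2 (cycleThrough τ (cycleElem τ c i)) + _ = _
  rw [glueCycles_cycleElem, cycleThrough_cycleElem]

/-- `placeProd` as an affine map. -/
noncomputable def placeProdAffine (w : V → ℝ) :
    (((c : Cycles τ) → Fin (cycleLength τ c) → ℝ) × (Cycles τ → ℝ)) →ᵃ[ℝ] (V → ℝ) where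
  toFun := placeProd τ w
  linear :=
    { toFun := placeProd τ 0
      map_add' := fun p q => by ext v; simp [placeProd]; ring
      map_smul' := fun a p => by ext v; simp [placeProd]; ring }
  map_vadd' p q := by ext v; simp [placeProd]; ring

/-- Coordinate sums are constant on a permutohedron, so the sum over a cycle determines the segment
coordinate, and then the rest. -/
theorem injOn_placeProd (w : V → ℝ) : Set.InjOn (placeProd τ w) (permutohedraProd τ) := by
  rintro ⟨p, t⟩ hp ⟨q, u⟩ hq h
  have hv : ∀ c i, p c i + t c = q c i + u c := fun c i => by
    simpa using congrFun h (cycleElem τ c i)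
  have htu : t = u := by
    funext c
    have hs : ∑ i, (p c i + t c) = ∑ i, (q c i + u c) := Finset.sum_congr rfl fun i _ => hv c i
    have hm : (0 : ℝ) < cycleLength τ c := Nat.cast_pos.2 (cycleLength_pos' τ c)
    rw [Finset.sum_add_distrib, Finset.sum_add_distrib,
      sum_of_mem_permutohedron (hp.1 c (Set.mem_univ c)),
      sum_of_mem_permutohedron (hq.1 c (Set.mem_univ c))] at hs
    simp only [Finset.sum_const, Finset.card_univ, Fintype.card_fin, nsmul_eq_mul] at hs
    exact mul_left_cancel₀ hm.ne' (by linarith)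
  subst htu
  refine Prod.ext (funext fun c => funext fun i => ?_) rfl
  have := hv c i
  linarith

theorem exists_finite_permutohedraProd_eq_convexHull : ∃ s, s.Finite ∧
    permutohedraProd τ = convexHull ℝ s := by
  refine ⟨(Set.univ.pi fun c => Set.range fun (s : Equiv.Perm (Fin (cycleLength τ c)))
    (i : Fin (cycleLength τ c)) => ((s i : ℕ) : ℝ) + 1) ×ˢ (Set.univ.pi fun _ => {0, 1}), ?_, ?_⟩
  · exact (Set.Finite.pi fun c => Set.finite_range _).prod
      (Set.Finite.pi fun c => Set.toFinite _)
  · rw [convexHull_prod, convexHull_pi, convexHull_pi]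
    simp only [convexHull_pair, segment_eq_Icc (zero_le_one' ℝ)]
    rfl

theorem convex_permutohedraProd : Convex ℝ (permutohedraProd τ) := by
  obtain ⟨s, -, h⟩ := exists_finite_permutohedraProd_eq_convexHull τ
  exact h ▸ convex_convexHull ℝ s

theorem exists_finite_image_placeProd_eq_convexHull (w : V → ℝ) : ∃ s : Set (V → ℝ), s.Finite ∧
    placeProd τ w '' permutohedraProd τ = convexHull ℝ s := by
  obtain ⟨s, hs, h⟩ := exists_finite_permutohedraProd_eq_convexHull τ
  exact ⟨_, hs.image _, h ▸ (placeProdAffine τ w).image_convexHull s⟩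

theorem extremePoints_image_placeProd (w : V → ℝ) :
    Set.extremePoints ℝ (placeProd τ w '' permutohedraProd τ) = placeProd τ w ''
      ((Set.univ.pi fun c => Set.range fun (s : Equiv.Perm (Fin (cycleLength τ c)))
        (i : Fin (cycleLength τ c)) => ((s i : ℕ) : ℝ) + 1) ×ˢ (Set.univ.pi fun _ => {0, 1})) := by
  have h := extremePoints_image_of_injOn (placeProdAffine τ w) (convex_permutohedraProd τ)
    (injOn_placeProd τ w)
  refine h.trans (congrArg _ ?_)
  rw [permutohedraProd, extremePoints_prod, extremePoints_pi, extremePoints_pi]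
  simp only [extremePoints_permutohedron, extremePoints_unitInterval]

/-- The centres of the tiles. -/
noncomputable def tileCentre (z : V → ℤ) (k : Cycles τ → ℤ) (v : V) : ℝ :=
  -- The prism has centre `(m + 1) / 2 + 1 / 2` in each coordinate.
  ((cycleLength τ (cycleThrough τ v) : ℝ) + 2) / 2 - cyclePos τ v
    + cycleLength τ (cycleThrough τ v) * z v + k (cycleThrough τ v)

/-- The translation vectors of the tiles. -/
noncomputable def tileOffset (z : V → ℤ) (k : Cycles τ → ℤ) (v : V) : ℝ :=
  -cyclePos τ v + cycleLength τ (cycleThrough τ v) * z v + k (cycleThrough τ v)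

/-- The set of the centres of all tiles. -/
def tileCentres : Set (V → ℝ) := {a | ∃ z k, tileCentre τ z k = a}

theorem tileCentre_sub_tileCentre_cycleElem (z z' : V → ℤ) (k k' : Cycles τ → ℤ) (c : Cycles τ)
    (i : Fin (cycleLength τ c)) :
    tileCentre τ z' k' (cycleElem τ c i) - tileCentre τ z k (cycleElem τ c i)
      = cycleLength τ c * ((z' (cycleElem τ c i) - z (cycleElem τ c i) : ℤ) : ℝ)
        + ((k' c - k c : ℤ) : ℝ) := by
  simp only [tileCentre, cycleThrough_cycleElem]
  push_cast
  ring

theorem exists_int_tileCentres_sub :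
    ∀ a ∈ tileCentres τ, ∀ b ∈ tileCentres τ, ∀ v, ∃ j : ℤ, b v - a v = j := by
  rintro _ ⟨z, k, rfl⟩ _ ⟨z', k', rfl⟩ v
  obtain ⟨c, i, rfl⟩ := exists_eq_cycleElem τ v
  rw [tileCentre_sub_tileCentre_cycleElem]
  exact ⟨cycleLength τ c * (z' (cycleElem τ c i) - z (cycleElem τ c i)) + (k' c - k c), by
    push_cast; rfl⟩

theorem placeProd_sub_tileCentre (z : V → ℤ) (k : Cycles τ → ℤ)
    (p : ((c : Cycles τ) → Fin (cycleLength τ c) → ℝ) × (Cycles τ → ℝ)) (c : Cycles τ)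
    (i : Fin (cycleLength τ c)) :
    placeProd τ (tileOffset τ z k) p (cycleElem τ c i) - tileCentre τ z k (cycleElem τ c i)
      = p.1 c i + p.2 c - (cycleLength τ c + 2) / 2 := by
  simp only [placeProd_cycleElem, tileCentre, tileOffset, cycleThrough_cycleElem]
  ring

/-- Differences of centres form the product over the cycles of the lattices `m ℤ^m + ℤ (1, …, 1)`,
so the cell inequalities decouple. -/
theorem voronoiCell_tileCentre [Fintype V] (z : V → ℤ) (k : Cycles τ → ℤ) :
    voronoiCell (tileCentres τ) (tileCentre τ z k)
      = placeProd τ (tileOffset τ z k) '' permutohedraProd τ := by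
  classical
  have := Fintype.ofFinite (Cycles τ)
  ext x
  rw [mem_voronoiCell_iff]
  constructor
  · intro h
    have hc : ∀ c : Cycles τ, ∃ p ∈ permutohedron (cycleLength τ c), ∃ t ∈ Set.Icc (0 : ℝ) 1,
        ∀ i, x (cycleElem τ c i) - tileCentre τ z k (cycleElem τ c i)
          = p i + t - (cycleLength τ c + 2) / 2 := by
      intro c
      refine (forall_two_mul_sum_mul_le_iff (cycleLength_pos' τ c) _).1 fun z' k' => ?_
      -- Comparison with a centre that differs only on the cycle `c` isolates the inequality of this
      -- cycle.
      have hb := h _ ⟨fun v => z v + glueCycles τ (Pi.single c z') v,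
        fun d => k d + (Pi.single c k' : Cycles τ → ℤ) d, rfl⟩
      rw [sum_cycleElem τ, sum_cycleElem τ] at hb
      simp only [tileCentre_sub_tileCentre_cycleElem, add_sub_cancel_left,
        glueCycles_cycleElem] at hb
      rw [Finset.sum_eq_single c, Finset.sum_eq_single c] at hb
      · simpa using hb
      · intro d _ hd
        simp [Pi.single_eq_of_ne hd]
      · simp
      · intro d _ hd
        simp [Pi.single_eq_of_ne hd]
      · simp
    choose p hp t ht hpt using hc
    refine ⟨(p, t), ⟨fun c _ => hp c, fun c _ => ht c⟩, funext fun v => ?_⟩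
    obtain ⟨c, i, rfl⟩ := exists_eq_cycleElem τ v
    have h1 := placeProd_sub_tileCentre τ z k (p, t) c i
    rw [← hpt] at h1
    linarith
  · rintro ⟨p, hp, rfl⟩ _ ⟨z', k', rfl⟩
    rw [sum_cycleElem τ, sum_cycleElem τ, Finset.mul_sum]
    refine Finset.sum_le_sum fun c _ => ?_
    simp only [tileCentre_sub_tileCentre_cycleElem, placeProd_sub_tileCentre]
    exact (forall_two_mul_sum_mul_le_iff (cycleLength_pos' τ c) _).2
      ⟨p.1 c, hp.1 c (Set.mem_univ c), p.2 c, hp.2 c (Set.mem_univ c), fun i => rfl⟩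
      (fun i => z' (cycleElem τ c i) - z (cycleElem τ c i)) (k' c - k c)

theorem isTessellation_tiles [Fintype V] :
    IsTessellation (voronoiCell (tileCentres τ) '' tileCentres τ) := by
  refine isTessellation_voronoi (R := Nat.card V + 1) ⟨_, 0, 0, rfl⟩ (exists_int_tileCentres_sub τ)
    ?_ ?_
  · rintro _ ⟨z, k, rfl⟩
    rw [voronoiCell_tileCentre]
    exact exists_finite_image_placeProd_eq_convexHull τ _
  · rintro _ ⟨z, k, rfl⟩ x hx v
    rw [voronoiCell_tileCentre] at hx
    obtain ⟨p, hp, rfl⟩ := hx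
    obtain ⟨c, i, rfl⟩ := exists_eq_cycleElem τ v
    rw [placeProd_sub_tileCentre, abs_le]
    have h1 := le_of_mem_permutohedron (hp.1 c (Set.mem_univ c)) i
    have h2 := hp.2 c (Set.mem_univ c)
    have h3 : (cycleLength τ c : ℝ) ≤ Nat.card V := Nat.cast_le.2 (Finite.card_subtype_le _)
    have h4 : (0 : ℝ) ≤ cycleLength τ c := Nat.cast_nonneg _
    constructor <;> linarith [h1.1, h1.2, h2.1, h2.2]

theorem iUnion_extremePoints_tiles [Fintype V] :
    (⋃ P ∈ voronoiCell (tileCentres τ) '' tileCentres τ, Set.extremePoints ℝ P)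
      = invertiblePoints τ := by
  ext x
  simp only [Set.mem_iUnion, exists_prop]
  constructor
  · rintro ⟨_, ⟨_, ⟨z, k, rfl⟩, rfl⟩, hx⟩
    rw [voronoiCell_tileCentre, extremePoints_image_placeProd] at hx
    obtain ⟨⟨p, t⟩, ⟨hp, ht⟩, rfl⟩ := hx
    choose s hs using fun c => hp c (Set.mem_univ c)
    -- At a vertex `t c` is `0` or `1`, an integer that joins the diagonal shift `k c`.
    have ht' : ∀ c, ∃ j : ℤ, t c = j := fun c => by
      rcases ht c (Set.mem_univ c) with h | h
      · exact ⟨0, by rw [Int.cast_zero]; exact h⟩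
      · exact ⟨1, by rw [Int.cast_one]; exact h⟩
    choose j hj using ht'
    let f : (c : Cycles τ) → Fin (cycleLength τ c) → ℤ := fun c i => (s c i : ℕ) + 1
      - cyclePos τ (cycleElem τ c i) + cycleLength τ c * z (cycleElem τ c i) + (j c + k c)
    obtain ⟨u, hu⟩ := TwistedMap.isUnit_of_eq ⟨glueCycles τ f⟩ s z (fun c => j c + k c)
      fun c i => glueCycles_cycleElem τ f c i
    refine ⟨u, funext fun v => ?_⟩
    obtain ⟨c, i, rfl⟩ := exists_eq_cycleElem τ v
    have hpc : p c i = ((s c i : ℕ) : ℝ) + 1 := (congrFun (hs c) i).symm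
    simp only [hu, glueCycles_cycleElem, placeProd_cycleElem, tileOffset, cycleThrough_cycleElem,
      hpc, hj, f]
    push_cast
    ring
  · rintro ⟨u, rfl⟩
    obtain ⟨s, z, h⟩ := TwistedMap.exists_eq_of_isUnit u.isUnit
    -- No diagonal shift is needed: the point is a vertex on the bottom `t = 0` of its tile.
    refine ⟨_, ⟨_, ⟨z, 0, rfl⟩, rfl⟩, ?_⟩
    rw [voronoiCell_tileCentre, extremePoints_image_placeProd]
    refine ⟨(fun c i => ((s c i : ℕ) : ℝ) + 1, 0), ⟨fun c _ => ⟨s c, rfl⟩, fun c _ => by simp⟩,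
      funext fun v => ?_⟩
    obtain ⟨c, i, rfl⟩ := exists_eq_cycleElem τ v
    simp only [h, placeProd_cycleElem, tileOffset, cycleThrough_cycleElem, Pi.zero_apply]
    push_cast
    ring

end Tiles

theorem theorem2 {n : ℕ} (τ : Equiv.Perm (Fin n)) :
    (∃ T : Set (Set (Fin n → ℝ)),
      IsTessellation T ∧
      (∀ P ∈ T, ∃ w : Fin n → ℝ,
        Set.InjOn (placeProd τ w) (permutohedraProd τ) ∧
        P = placeProd τ w '' permutohedraProd τ) ∧
      (⋃ P ∈ T, Set.extremePoints ℝ P) = invertiblePoints τ) ∧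
    Nonempty (InvertibleGroup τ ≃* ((c : Cycles τ) → LatticeSemidirect (cycleLength τ c))) := by
  refine ⟨⟨_, isTessellation_tiles τ, ?_, iUnion_extremePoints_tiles τ⟩,
    ⟨MulEquiv.ofBijective (toLatticeSemidirect τ)
      ⟨toLatticeSemidirect_injective τ, toLatticeSemidirect_surjective τ⟩⟩⟩
  rintro _ ⟨_, ⟨z, k, rfl⟩, rfl⟩
  exact ⟨_, injOn_placeProd τ _, voronoiCell_tileCentre τ z k⟩
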